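/- Let $\mathbb{U}=\{z\in\mathbb{C}:|z|<1\}$, let $\lambda\ge 1$, $\delta\ge 1$, $t\in(1/2,1]$, and let $f(z)=z+\sum_{n\ge2}a_nz^n$ be analytic in $\mathbb{U}$. Put $$f_\delta(z)=\int_0^z\Big(\frac{1+r}{1-r}\Big)^{\delta}\frac{dr}{1-r^2}=z+\sum_{n\ge2}b_n(\delta)z^n,\qquad h_\delta(z)=(f*f_\delta)(z)=z+\sum_{n\ge2}a_nb_n(\delta)z^n .$$ Suppose that $h_\delta$ is bi-univalent, that is, $h_\delta$ is univalent in $\mathbb{U}$ and its inverse near $0$ extends to a univalent analytic function $k_\delta=h_\delta^{-1}$ in $\mathbb{U}$, and that $h_\delta$ belongs to the class $\mathcal{B}_\sigma^\delta(\lambda,t)$, that is, $$(1-\lambda)\frac{h_\delta(z)}{z}+\lambda h_\delta'(z)\prec G(t,z),\qquad (1-\lambda)\frac{k_\delta(w)}{w}+\lambda k_\delta'(w)\prec G(t,w),\qquad G(t,z)=\frac1{1-2tz+z^2},$$ where quotients are extended analytically to the origin and $F\prec G$ means $F=G\circ\omega$ in $\mathbb{U}$ for some analytic $\omega:\mathbb{U}\to\mathbb{U}$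 with $\omega(0)=0$. Let $U_1(t)=2t$, $U_2(t)=4t^2-1$, $U_3(t)=8t^3-4t$ be the Chebyshev polynomials of the second kind and, for real $\mu$, put $$\Omega_{\lambda,\mu,\delta}(t)=18(2\delta^2+1)^2(\lambda+\mu)^3U_3(t)-U_1^3(t)(3\lambda+\mu)\big(3(2\delta^2+1)^2(\mu^2+3\mu-4)+54\delta(\delta^3+2\delta)\big),$$ \begin{align*} \chi_1(\lambda,\mu,\delta;t)={}&(2\lambda+\mu)^2U_1(t)\,|\Omega_{\lambda,\mu,\delta}(t)|\\ &+18(\lambda+\mu)^3\big(3\delta(\delta^3+2\delta)(\lambda+\mu)(3\lambda+\mu)-(2\delta^2+1)^2(2\lambda+\mu)^2\big)U_1^2(t)\\ &-9(\lambda+\mu)^2(2\lambda+\mu)U_1(t)\big((3\lambda+\mu)(8\delta^4-4\delta^2+5)U_1^2(t)+4(2\delta^2+1)^2(2\lambda+\mu)(\lambda+\mu)U_2(t)\big),\\ \chi_2(\lambda,\mu,\delta;t)={}&\Big[(2\lambda+\mu)(3\lambda+\mu)(8\delta^4-4\delta^2+5)U_1^3(t)+4(2\delta^2+1)^2(\lambda+\mu)(2\lambda+\mu)^2U_1(t)U_2(t)\\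 &+(\lambda+\mu)U_1^2(t)\big(2(2\delta^2+1)^2(2\lambda+\mu)^2-12\delta(\delta^3+2\delta)(\lambda+\mu)(3\lambda+\mu)\big)\Big](\lambda+\mu)^2, \end{align*} and $\chi_3=\chi_1(\lambda,1,\delta;t)$, $\chi_4=\chi_2(\lambda,1,\delta;t)$. Then $$|a_2a_4-a_3^2|\le\begin{cases} \varphi(2^-,t), & \chi_3\ge0\text{ and }\chi_4\ge0,\\ \dfrac{36t^2}{(2\delta^2+1)^2(2\lambda+1)^2}, & \chi_3\le0\text{ and }\chi_4\le0,\\ \max\Big\{\dfrac{36t^2}{(2\delta^2+1)^2(2\lambda+1)^2},\ \varphi(2^-,t)\Big\}, & \chi_3>0\text{ and }\chi_4<0,\\ \max\{\varphi(c_0,t),\ \varphi(2^-,t)\}, & \chi_3<0\text{ and }\chi_4>0, \end{cases}$$ where the symbols $\varphi(2^-,t)$ and $\varphi(c_0,t)$ stand for $$\varphi(2^-,t)=\frac{9U_1^2(t)}{(2\delta^2+1)^2(2\lambda+1)^2}+\frac{\chi_3+9\chi_4}{6\delta(\delta^3+2\delta)(2\delta^2+1)^2(3\lambda+1)(2\lambda+1)^2(\lambda+1)^4},$$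 $$\varphi(c_0,t)=\frac{9U_1^2(t)}{(2\delta^2+1)^2(2\lambda+1)^2}-\frac{27\chi_4^2}{8\chi_3\,\delta(\delta^3+2\delta)(2\delta^2+1)^2(3\lambda+1)(2\lambda+1)^2(\lambda+1)^4}.$$ -/

import Mathlib

open Filter Topology

noncomputable section

namespace BiUnivalent

/-- The open unit disk of the complex plane. -/
def unitDisk : Set ℂ := Metric.ball 0 1

/-- The class of functions analytic in the unit disk with `f 0 = 0` and `f' 0 = 1`.
Values outside the disk play no role. -/
def classA : Set (ℂ → ℂ) :=
  {f | DifferentiableOn ℂ f unitDisk ∧ f 0 = 0 ∧ deriv f 0 = 1}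

/-- The `n`-th Taylor coefficient of `f` at the origin. -/
def taylorCoeff (f : ℂ → ℂ) (n : ℕ) : ℂ := iteratedDeriv n f 0 / (n.factorial : ℂ)

/-- The Hadamard product (convolution): the power series whose coefficients are the products
of the Taylor coefficients of `f` and `g`. -/
def hadamard (f g : ℂ → ℂ) (z : ℂ) : ℂ := ∑' n : ℕ, taylorCoeff f n * taylorCoeff g n * z ^ n

/-- The function `z ↦ ∫_0^z ((1 + r) / (1 - r)) ^ δ / (1 - r ^ 2) dr`, integrated along the
segment `r = s z`, `0 ≤ s ≤ 1`. In the unit disk `(1 + r) / (1 - r)` has positive real part, so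
that the principal power is the analytic branch. -/
def fDelta (δ : ℝ) (z : ℂ) : ℂ :=
  ∫ s in (0 : ℝ)..1,
    ((1 + (s : ℂ) * z) / (1 - (s : ℂ) * z)) ^ (δ : ℂ) * (1 / (1 - ((s : ℂ) * z) ^ 2)) * z

/-- `k` is (a function agreeing on the unit disk with) the inverse of `h`, continued from a
neighbourhood of the origin to the whole unit disk, and it is univalent there. -/
def IsUnivalentInverse (h k : ℂ → ℂ) : Prop :=
  DifferentiableOn ℂ k unitDisk ∧ Set.InjOn k unitDisk ∧ ∀ᶠ z in 𝓝 (0 : ℂ), k (h z) = z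

/-- The class `σ` of bi-univalent functions. -/
def classSigma : Set (ℂ → ℂ) :=
  {h | h ∈ classA ∧ Set.InjOn h unitDisk ∧ ∃ k, IsUnivalentInverse h k}

/-- Subordination `F ≺ G` in the unit disk. -/
def Subordinate (F G : ℂ → ℂ) : Prop :=
  ∃ w : ℂ → ℂ, DifferentiableOn ℂ w unitDisk ∧ w 0 = 0 ∧
    (∀ z ∈ unitDisk, ‖w z‖ < 1) ∧ ∀ z ∈ unitDisk, F z = G (w z)

/-- The generating function of the Chebyshev polynomials of the second kind. -/
def chebGen (t : ℝ) (z : ℂ) : ℂ := 1 / (1 - 2 * (t : ℂ) * z + z ^ 2)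

/-- `(1 - λ) h(z) / z + λ h'(z)`; here `dslope h 0 z` is `h z / z` for `z ≠ 0` (when `h 0 = 0`),
with the value `h' 0` at the removable singularity. -/
def bOperator (lam : ℝ) (h : ℂ → ℂ) (z : ℂ) : ℂ :=
  (1 - (lam : ℂ)) * dslope h 0 z + (lam : ℂ) * deriv h z

/-- The functions `h` in `σ` such that `h` and its inverse `k` satisfy
`(1 - λ) h(z) / z + λ h'(z) ≺ G` and `(1 - λ) k(w) / w + λ k'(w) ≺ G`. -/
def classB (lam t : ℝ) : Set (ℂ → ℂ) :=
  {h | h ∈ classSigma ∧ ∃ k, IsUnivalentInverse h k ∧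
    Subordinate (bOperator lam h) (chebGen t) ∧ Subordinate (bOperator lam k) (chebGen t)}

/-- The value at `t` of the Chebyshev polynomial of the second kind `U_n`. -/
def chebU (n : ℕ) (t : ℝ) : ℝ := (Polynomial.Chebyshev.U ℝ (n : ℤ)).eval t

/-- The quantity `Ω_{λ,μ,δ}(t)`. -/
def Omega (lam mu δ t : ℝ) : ℝ :=
  18 * (2 * δ ^ 2 + 1) ^ 2 * (lam + mu) ^ 3 * chebU 3 t
    - chebU 1 t ^ 3 * (3 * lam + mu)
      * (3 * (2 * δ ^ 2 + 1) ^ 2 * (mu ^ 2 + 3 * mu - 4) + 54 * δ * (δ ^ 3 + 2 * δ))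

/-- The quantity `χ₁(λ, μ, δ; t)`. -/
def chi1 (lam mu δ t : ℝ) : ℝ :=
  (2 * lam + mu) ^ 2 * chebU 1 t * |Omega lam mu δ t|
    + 18 * (lam + mu) ^ 3
      * (3 * δ * (δ ^ 3 + 2 * δ) * (lam + mu) * (3 * lam + mu)
        - (2 * δ ^ 2 + 1) ^ 2 * (2 * lam + mu) ^ 2) * chebU 1 t ^ 2
    - 9 * (lam + mu) ^ 2 * (2 * lam + mu) * chebU 1 t
      * ((3 * lam + mu) * (8 * δ ^ 4 - 4 * δ ^ 2 + 5) * chebU 1 t ^ 2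
        + 4 * (2 * δ ^ 2 + 1) ^ 2 * (2 * lam + mu) * (lam + mu) * chebU 2 t)

/-- The quantity `χ₂(λ, μ, δ; t)`. -/
def chi2 (lam mu δ t : ℝ) : ℝ :=
  ((2 * lam + mu) * (3 * lam + mu) * (8 * δ ^ 4 - 4 * δ ^ 2 + 5) * chebU 1 t ^ 3
    + 4 * (2 * δ ^ 2 + 1) ^ 2 * (lam + mu) * (2 * lam + mu) ^ 2 * chebU 1 t * chebU 2 t
    + (lam + mu) * chebU 1 t ^ 2
      * (2 * (2 * δ ^ 2 + 1) ^ 2 * (2 * lam + mu) ^ 2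
        - 12 * δ * (δ ^ 3 + 2 * δ) * (lam + mu) * (3 * lam + mu))) * (lam + mu) ^ 2

/-- `χ₃ = χ₁(λ, 1, δ; t)`. -/
def chi3 (lam δ t : ℝ) : ℝ := chi1 lam 1 δ t

/-- `χ₄ = χ₂(λ, 1, δ; t)`. -/
def chi4 (lam δ t : ℝ) : ℝ := chi2 lam 1 δ t

/-- The quantity `φ(2⁻, t)`. -/
def phiTwo (lam δ t : ℝ) : ℝ :=
  9 * chebU 1 t ^ 2 / ((2 * δ ^ 2 + 1) ^ 2 * (2 * lam + 1) ^ 2)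
    + (chi3 lam δ t + 9 * chi4 lam δ t)
      / (6 * δ * (δ ^ 3 + 2 * δ) * (2 * δ ^ 2 + 1) ^ 2 * (3 * lam + 1) * (2 * lam + 1) ^ 2
        * (lam + 1) ^ 4)

/-- The quantity `φ(c₀, t)`, used only where `χ₃ < 0`. -/
def phiCrit (lam δ t : ℝ) : ℝ :=
  9 * chebU 1 t ^ 2 / ((2 * δ ^ 2 + 1) ^ 2 * (2 * lam + 1) ^ 2)
    - 27 * chi4 lam δ t ^ 2
      / (8 * chi3 lam δ t * δ * (δ ^ 3 + 2 * δ) * (2 * δ ^ 2 + 1) ^ 2 * (3 * lam + 1)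
        * (2 * lam + 1) ^ 2 * (lam + 1) ^ 4)

end BiUnivalent

end

namespace BiUnivalent

/-! Write `A_n` for the coefficients of `h`, and `B = δ(δ³+2δ)`, `D = (2δ²+1)²`. The explicit `b_n`
turn the determinant into `(3/B) A₂A₄ - (9/D) A₃²`. Comparing coefficients in the two
subordinations, with those of the inverse expressed through `A₂, A₃, A₄`, gives six equations in the
coefficients `c_i`, `d_i` of the two Schwarz functions. They force `d₁ = -c₁` and determine the
`A_n`, so the determinant becomes a polynomial in the Schwarz coefficients (`hankel_expansion`).

The Schur algorithm (`exists_schwarz_coeff`) parametrises these by `c = c₁` and points `ξ, η` of the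
closed disk, up to remainders of size at most `1 - |ξ|²` and `1 - |η|²`. After the triangle
inequality the estimate is largest at `|ξ| = |η| = 1` (`schur_bound_le`). What remains is a
quadratic in `y = |c|² ∈ [0,1]`, namely `9U₁²/(D(2λ+1)²) + (χ₃y² + 9χ₄y)/M` (`hankel_quadratic_eq`).
Its value at `y = 0` is the explicit bound, at `y = 1` it is `phiTwo`, and at the vertex `phiCrit`;
the four cases are the sign patterns of `χ₃, χ₄`. -/

/-! ### Taylor coefficients of products, compositions and inverses. -/

theorem taylorCoeff_congr {f g : ℂ → ℂ} (h : f =ᶠ[𝓝 0] g) (n : ℕ) :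
    taylorCoeff f n = taylorCoeff g n := by
  rw [taylorCoeff, taylorCoeff, h.iteratedDeriv_eq]

theorem taylorCoeff_zero (f : ℂ → ℂ) : taylorCoeff f 0 = f 0 := by
  simp [taylorCoeff]

theorem taylorCoeff_one (f : ℂ → ℂ) : taylorCoeff f 1 = deriv f 0 := by
  simp [taylorCoeff, iteratedDeriv_one]

theorem taylorCoeff_deriv (f : ℂ → ℂ) (n : ℕ) :
    taylorCoeff (deriv f) n = (n + 1) * taylorCoeff f (n + 1) := by
  rw [taylorCoeff, taylorCoeff, iteratedDeriv_succ', Nat.factorial_succ]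
  have : (n.factorial : ℂ) ≠ 0 := by exact_mod_cast n.factorial_ne_zero
  have : (n + 1 : ℂ) ≠ 0 := by exact_mod_cast n.succ_ne_zero
  push_cast
  field_simp

theorem taylorCoeff_add {f g : ℂ → ℂ} (hf : AnalyticAt ℂ f 0) (hg : AnalyticAt ℂ g 0) (n : ℕ) :
    taylorCoeff (fun z => f z + g z) n = taylorCoeff f n + taylorCoeff g n := by
  have := iteratedDeriv_add (n := n) hf.contDiffAt hg.contDiffAt
  rw [taylorCoeff, taylorCoeff, taylorCoeff, ← add_div, ← this]
  rfl

theorem taylorCoeff_sub {f g : ℂ → ℂ} (hf : AnalyticAt ℂ f 0) (hg : AnalyticAt ℂ g 0) (n : ℕ) :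
    taylorCoeff (fun z => f z - g z) n = taylorCoeff f n - taylorCoeff g n := by
  have := iteratedDeriv_sub (n := n) hf.contDiffAt hg.contDiffAt
  rw [taylorCoeff, taylorCoeff, taylorCoeff, ← sub_div, ← this]
  rfl

theorem taylorCoeff_const_mul (c : ℂ) (f : ℂ → ℂ) (n : ℕ) :
    taylorCoeff (fun z => c * f z) n = c * taylorCoeff f n := by
  rw [taylorCoeff, taylorCoeff, iteratedDeriv_const_mul_field, mul_div_assoc]

theorem taylorCoeff_mul {f g : ℂ → ℂ} (hf : AnalyticAt ℂ f 0) (hg : AnalyticAt ℂ g 0) (n : ℕ) :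
    taylorCoeff (fun z => f z * g z) n =
      ∑ i ∈ Finset.range (n + 1), taylorCoeff f i * taylorCoeff g (n - i) := by
  have := iteratedDeriv_fun_mul (n := n) hf.contDiffAt hg.contDiffAt
  rw [taylorCoeff, this, Finset.sum_div]
  refine Finset.sum_congr rfl fun i hi => ?_
  have hi : i ≤ n := by simpa [Nat.lt_succ_iff] using hi
  rw [Nat.cast_choose ℂ hi, taylorCoeff, taylorCoeff]
  have h1 : (n.factorial : ℂ) ≠ 0 := by exact_mod_cast n.factorial_ne_zero
  have h2 : (i.factorial : ℂ) ≠ 0 := by exact_mod_cast i.factorial_ne_zero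
  have h3 : ((n - i).factorial : ℂ) ≠ 0 := by exact_mod_cast (n - i).factorial_ne_zero
  field_simp

theorem taylorCoeff_const_succ (c : ℂ) (n : ℕ) : taylorCoeff (fun _ => c) (n + 1) = 0 := by
  simp [taylorCoeff, iteratedDeriv_const]

theorem taylorCoeff_id_of_two_le (n : ℕ) : taylorCoeff (fun z => z) (n + 2) = 0 := by
  have h : deriv (fun z : ℂ => z) = fun _ => 1 := by ext; simp
  rw [taylorCoeff, iteratedDeriv_succ', h]
  simp [iteratedDeriv_const]

theorem analyticAt_fun_self : AnalyticAt ℂ (fun z : ℂ => z) 0 := analyticAt_id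

theorem taylorCoeff_id_mul {f : ℂ → ℂ} (hf : AnalyticAt ℂ f 0) (n : ℕ) :
    taylorCoeff (fun z => z * f z) (n + 1) = taylorCoeff f n := by
  rw [taylorCoeff_mul analyticAt_fun_self hf, Finset.sum_range_succ', Finset.sum_range_succ',
    Finset.sum_eq_zero]
  · simp [taylorCoeff_zero, taylorCoeff_one]
  · intro i _
    simp [taylorCoeff_id_of_two_le]

theorem analyticAt_dslope {f : ℂ → ℂ} (hf : AnalyticAt ℂ f 0) : AnalyticAt ℂ (dslope f 0) 0 := by
  obtain ⟨p, hp⟩ := hf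
  exact hp.has_fpower_series_dslope_fslope.analyticAt

theorem eq_add_mul_dslope (f : ℂ → ℂ) (z : ℂ) : f z = f 0 + z * dslope f 0 z := by
  have := sub_smul_dslope f 0 z
  simp only [sub_zero, smul_eq_mul] at this
  rw [this]; ring

theorem taylorCoeff_dslope {f : ℂ → ℂ} (hf : AnalyticAt ℂ f 0) (n : ℕ) :
    taylorCoeff (dslope f 0) n = taylorCoeff f (n + 1) := by
  have hd := analyticAt_dslope hf
  rw [← taylorCoeff_id_mul hd n,
    taylorCoeff_congr (f := f) (g := fun z => f 0 + z * dslope f 0 z)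
      (Eventually.of_forall (eq_add_mul_dslope f)),
    taylorCoeff_add analyticAt_const (analyticAt_fun_self.fun_mul hd), taylorCoeff_const_succ, zero_add]

/-- From `g(h) = g(0) + h · (dslope g 0)(h)`: each use lowers the order by one, giving a recursion
for the coefficients of a composition. -/
theorem taylorCoeff_comp_succ {g h : ℂ → ℂ} (hg : AnalyticAt ℂ g 0) (hh : AnalyticAt ℂ h 0)
    (h0 : h 0 = 0) (n : ℕ) :
    taylorCoeff (fun z => g (h z)) (n + 1) = ∑ i ∈ Finset.range (n + 1),
      taylorCoeff h (i + 1) * taylorCoeff (fun z => dslope g 0 (h z)) (n - i) := by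
  have hd := analyticAt_dslope hg
  have hc : AnalyticAt ℂ (fun z => dslope g 0 (h z)) 0 :=
    AnalyticAt.fun_comp (by rwa [h0]) hh
  rw [taylorCoeff_congr (g := fun z => g 0 + h z * dslope g 0 (h z))
      (Eventually.of_forall fun z => eq_add_mul_dslope g (h z)),
    taylorCoeff_add analyticAt_const (hh.fun_mul hc), taylorCoeff_const_succ, zero_add,
    taylorCoeff_mul hh hc, Finset.sum_range_succ', taylorCoeff_zero, h0, zero_mul, add_zero]
  simp

/-- The first coefficients of the inverse function. -/
theorem taylorCoeff_inverse {h k : ℂ → ℂ} (hk : AnalyticAt ℂ k 0) (hh : AnalyticAt ℂ h 0)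
    (h0 : h 0 = 0) (h1 : taylorCoeff h 1 = 1) (hkh : ∀ᶠ z in 𝓝 (0 : ℂ), k (h z) = z) :
    taylorCoeff k 1 = 1 ∧ taylorCoeff k 2 = -taylorCoeff h 2 ∧
      taylorCoeff k 3 = 2 * taylorCoeff h 2 ^ 2 - taylorCoeff h 3 ∧
      taylorCoeff k 4 = -5 * taylorCoeff h 2 ^ 3 + 5 * taylorCoeff h 2 * taylorCoeff h 3
        - taylorCoeff h 4 := by
  -- These formulas are needed for every `g`, because each order calls the lower ones at `dslope g
  -- 0`.
  have c0 : ∀ g : ℂ → ℂ, taylorCoeff (fun z => g (h z)) 0 = taylorCoeff g 0 := fun g => by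
    simp [taylorCoeff_zero, h0]
  have c1 : ∀ g : ℂ → ℂ, AnalyticAt ℂ g 0 →
      taylorCoeff (fun z => g (h z)) 1 = taylorCoeff g 1 := fun g hg => by
    rw [taylorCoeff_comp_succ hg hh h0]
    simp [c0, taylorCoeff_dslope hg, h1]
  have c2 : ∀ g : ℂ → ℂ, AnalyticAt ℂ g 0 → taylorCoeff (fun z => g (h z)) 2 =
      taylorCoeff g 2 + taylorCoeff h 2 * taylorCoeff g 1 := fun g hg => by
    rw [taylorCoeff_comp_succ hg hh h0]
    simp [Finset.sum_range_succ, c0, c1 _ (analyticAt_dslope hg), taylorCoeff_dslope hg, h1]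
  have c3 : ∀ g : ℂ → ℂ, AnalyticAt ℂ g 0 → taylorCoeff (fun z => g (h z)) 3 =
      taylorCoeff g 3 + 2 * taylorCoeff h 2 * taylorCoeff g 2
        + taylorCoeff h 3 * taylorCoeff g 1 := fun g hg => by
    have hd := analyticAt_dslope hg
    rw [taylorCoeff_comp_succ hg hh h0]
    simp only [Finset.sum_range_succ, Finset.sum_range_zero, Nat.reduceSub, Nat.reduceAdd, c0,
      c1 _ hd, c2 _ hd, taylorCoeff_dslope hg, h1]
    ring
  have c4 : ∀ g : ℂ → ℂ, AnalyticAt ℂ g 0 → taylorCoeff (fun z => g (h z)) 4 =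
      taylorCoeff g 4 + 3 * taylorCoeff h 2 * taylorCoeff g 3
        + (2 * taylorCoeff h 3 + taylorCoeff h 2 ^ 2) * taylorCoeff g 2
        + taylorCoeff h 4 * taylorCoeff g 1 := fun g hg => by
    have hd := analyticAt_dslope hg
    rw [taylorCoeff_comp_succ hg hh h0]
    simp only [Finset.sum_range_succ, Finset.sum_range_zero, Nat.reduceSub, Nat.reduceAdd, c0,
      c1 _ hd, c2 _ hd, c3 _ hd, taylorCoeff_dslope hg, h1]
    ring
  have e := fun n => taylorCoeff_congr (g := fun z => z) hkh n
  have e1 := (c1 k hk).symm.trans (e 1)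
  have e2 := (c2 k hk).symm.trans (e 2)
  have e3 := (c3 k hk).symm.trans (e 3)
  have e4 := (c4 k hk).symm.trans (e 4)
  rw [taylorCoeff_id_of_two_le 0] at e2
  rw [taylorCoeff_id_of_two_le 1] at e3
  rw [taylorCoeff_id_of_two_le 2] at e4
  have e1' : taylorCoeff k 1 = 1 := by rw [e1, taylorCoeff_one]; simp
  rw [e1'] at e2 e3 e4
  have e2' : taylorCoeff k 2 = -taylorCoeff h 2 := by linear_combination e2
  rw [e2'] at e3 e4
  have e3' : taylorCoeff k 3 = 2 * taylorCoeff h 2 ^ 2 - taylorCoeff h 3 := by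
    linear_combination e3
  rw [e3'] at e4
  exact ⟨e1', e2', e3', by linear_combination e4⟩

/-! ### Coefficients under subordination to the Chebyshev generating function. -/

theorem analyticAt_of_unitDisk {f : ℂ → ℂ} (hf : DifferentiableOn ℂ f unitDisk) :
    AnalyticAt ℂ f 0 :=
  hf.analyticAt (Metric.isOpen_ball.mem_nhds (by simp))

theorem unitDisk_mem_nhds : unitDisk ∈ 𝓝 (0 : ℂ) := Metric.isOpen_ball.mem_nhds (by simp)

theorem taylorCoeff_bOperator {h : ℂ → ℂ} (hh : AnalyticAt ℂ h 0) (lam : ℝ) (n : ℕ) :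
    taylorCoeff (bOperator lam h) n = (1 + n * lam) * taylorCoeff h (n + 1) := by
  have hd := analyticAt_dslope hh
  unfold bOperator
  rw [taylorCoeff_add (analyticAt_const.fun_mul hd) (analyticAt_const.fun_mul hh.deriv),
    taylorCoeff_const_mul, taylorCoeff_const_mul, taylorCoeff_dslope hh, taylorCoeff_deriv]
  ring

/-- The coefficients of a function subordinate to the generating function of the Chebyshev
polynomials, in terms of the coefficients of the Schwarz function. -/
theorem taylorCoeff_of_eq_chebGen {F w : ℂ → ℂ} {t : ℝ} (hF : AnalyticAt ℂ F 0)
    (hw : DifferentiableOn ℂ w unitDisk) (hw0 : w 0 = 0)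
    (hFw : ∀ z ∈ unitDisk, F z = chebGen t (w z)) :
    taylorCoeff F 1 = 2 * t * taylorCoeff w 1 ∧
    taylorCoeff F 2 = 2 * t * taylorCoeff w 2 + (4 * t ^ 2 - 1) * taylorCoeff w 1 ^ 2 ∧
    taylorCoeff F 3 = 2 * t * taylorCoeff w 3
      + 2 * (4 * t ^ 2 - 1) * taylorCoeff w 1 * taylorCoeff w 2
      + (8 * t ^ 3 - 4 * t) * taylorCoeff w 1 ^ 3 := by
  have hwa := analyticAt_of_unitDisk hw
  -- `1 + Q` is the denominator `1 - 2tw + w²`, so the coefficients can be read off from `F + F Q =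
  -- 1` without expanding a quotient.
  set Q : ℂ → ℂ := fun z => w z * (w z - 2 * t) with hQ
  have hwt : AnalyticAt ℂ (fun z => w z - 2 * t) 0 := hwa.sub analyticAt_const
  have hQa : AnalyticAt ℂ Q 0 := hwa.mul hwt
  have hev : (fun z => F z + F z * Q z) =ᶠ[𝓝 0] fun _ => 1 := by
    have hne : ∀ᶠ z in 𝓝 (0 : ℂ), 1 + Q z ≠ 0 := by
      have : ContinuousAt (fun z => 1 + Q z) 0 := continuousAt_const.add hQa.continuousAt
      exact this.eventually_ne (by simp [hQ, hw0])
    filter_upwards [unitDisk_mem_nhds, hne] with z hz hz'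
    rw [hFw z hz, chebGen]
    have : 1 - 2 * (t : ℂ) * w z + w z ^ 2 = 1 + Q z := by simp only [hQ]; ring
    rw [this]
    field_simp
  have hE : ∀ n, taylorCoeff F n
      + ∑ i ∈ Finset.range (n + 1), taylorCoeff F i * taylorCoeff Q (n - i)
      = taylorCoeff (fun _ => 1) n := fun n => by
    rw [← taylorCoeff_mul hF hQa, ← taylorCoeff_add hF (hF.fun_mul hQa)]
    exact taylorCoeff_congr hev n
  have hwc0 : taylorCoeff w 0 = 0 := by rw [taylorCoeff_zero, hw0]
  have hwt0 : taylorCoeff (fun z => w z - 2 * t) 0 = -(2 * t) := by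
    rw [taylorCoeff_zero, hw0, zero_sub]
  have hwts : ∀ n, taylorCoeff (fun z => w z - 2 * t) (n + 1) = taylorCoeff w (n + 1) := fun n => by
    rw [taylorCoeff_sub hwa analyticAt_const, taylorCoeff_const_succ, sub_zero]
  have hQm : ∀ n, taylorCoeff Q n = ∑ i ∈ Finset.range (n + 1),
      taylorCoeff w i * taylorCoeff (fun z => w z - 2 * t) (n - i) := fun n =>
    taylorCoeff_mul hwa hwt n
  have Q0 : taylorCoeff Q 0 = 0 := by rw [taylorCoeff_zero]; simp [hQ, hw0]
  have Q1 : taylorCoeff Q 1 = -(2 * t) * taylorCoeff w 1 := by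
    rw [hQm]; simp only [Finset.sum_range_succ, Finset.sum_range_zero, Nat.reduceSub, Nat.reduceAdd,
      hwc0, hwt0, hwts 0]
    ring
  have Q2 : taylorCoeff Q 2 = -(2 * t) * taylorCoeff w 2 + taylorCoeff w 1 ^ 2 := by
    rw [hQm]; simp only [Finset.sum_range_succ, Finset.sum_range_zero, Nat.reduceSub, Nat.reduceAdd,
      hwc0, hwt0, hwts 0, hwts 1]
    ring
  have Q3 : taylorCoeff Q 3 = -(2 * t) * taylorCoeff w 3 + 2 * taylorCoeff w 1 * taylorCoeff w 2 := by
    rw [hQm]; simp only [Finset.sum_range_succ, Finset.sum_range_zero, Nat.reduceSub, Nat.reduceAdd,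
      hwc0, hwt0, hwts 0, hwts 1, hwts 2]
    ring
  have E0 := hE 0
  have E1 := hE 1
  have E2 := hE 2
  have E3 := hE 3
  rw [taylorCoeff_zero (fun _ => 1)] at E0
  rw [taylorCoeff_const_succ 1 0] at E1
  rw [taylorCoeff_const_succ 1 1] at E2
  rw [taylorCoeff_const_succ 1 2] at E3
  simp only [Finset.sum_range_succ, Finset.sum_range_zero, Nat.reduceSub, Nat.reduceAdd, Q0, Q1, Q2,
    Q3, mul_zero, zero_add, add_zero] at E0 E1 E2 E3
  rw [E0] at E1 E2 E3
  have R1 : taylorCoeff F 1 = 2 * t * taylorCoeff w 1 := by linear_combination E1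
  rw [R1] at E2 E3
  have R2 : taylorCoeff F 2 = 2 * t * taylorCoeff w 2 + (4 * t ^ 2 - 1) * taylorCoeff w 1 ^ 2 := by
    linear_combination E2
  rw [R2] at E3
  exact ⟨R1, R2, by linear_combination E3⟩

/-! ### Schwarz functions and the Schur algorithm. -/

/-- The difference of the squares of the two sides is `(1 - |a|²)(1 - |z|²)`. -/
theorem norm_sub_le_norm_one_sub_conj_mul {a z : ℂ} (ha : ‖a‖ ≤ 1) (hz : ‖z‖ ≤ 1) :
    ‖z - a‖ ≤ ‖1 - (starRingEnd ℂ) a * z‖ := by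
  have h1 : a.re ^ 2 + a.im ^ 2 ≤ 1 := by
    have := Complex.sq_norm a
    rw [Complex.normSq_apply] at this
    nlinarith [norm_nonneg a]
  have h2 : z.re ^ 2 + z.im ^ 2 ≤ 1 := by
    have := Complex.sq_norm z
    rw [Complex.normSq_apply] at this
    nlinarith [norm_nonneg z]
  refine le_of_sq_le_sq ?_ (norm_nonneg _)
  rw [Complex.sq_norm, Complex.sq_norm, Complex.normSq_apply, Complex.normSq_apply]
  simp only [Complex.sub_re, Complex.sub_im, Complex.mul_re, Complex.mul_im, Complex.conj_re,
    Complex.conj_im, Complex.one_re, Complex.one_im]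
  nlinarith [mul_nonneg (sub_nonneg.2 h1) (sub_nonneg.2 h2)]

/-- One step of the Schur algorithm. -/
theorem exists_schur_step {φ : ℂ → ℂ} (hd : DifferentiableOn ℂ φ unitDisk)
    (hb : ∀ z ∈ unitDisk, ‖φ z‖ ≤ 1) :
    ∃ ψ : ℂ → ℂ, DifferentiableOn ℂ ψ unitDisk ∧ (∀ z ∈ unitDisk, ‖ψ z‖ ≤ 1) ∧
      ∀ z ∈ unitDisk, φ z - φ 0 = z * (ψ z * (1 - (starRingEnd ℂ) (φ 0) * φ z)) := by
  have h0 : (0 : ℂ) ∈ unitDisk := by simp [unitDisk]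
  rcases (hb 0 h0).lt_or_eq with hlt | heq
  · have hne : ∀ z ∈ unitDisk, 1 - (starRingEnd ℂ) (φ 0) * φ z ≠ 0 := fun z hz h => by
      have h' : ‖(starRingEnd ℂ) (φ 0) * φ z‖ = 1 := by rw [← sub_eq_zero.1 h, norm_one]
      rw [norm_mul, RCLike.norm_conj] at h'
      nlinarith [hb z hz, norm_nonneg (φ 0), norm_nonneg (φ z)]
    -- A disk automorphism moves `φ 0` to the origin, and the Schwarz lemma then allows division by
    -- `z`.
    set B : ℂ → ℂ := fun z => (φ z - φ 0) / (1 - (starRingEnd ℂ) (φ 0) * φ z) with hB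
    have hBd : DifferentiableOn ℂ B unitDisk :=
      (hd.sub_const _).div ((hd.const_mul _).const_sub _) hne
    have hB0 : B 0 = 0 := by simp [hB]
    have hBm : Set.MapsTo B (Metric.ball 0 1) (Metric.closedBall (B 0) 1) := fun z hz => by
      rw [hB0, mem_closedBall_zero_iff, hB, norm_div]
      exact div_le_one_of_le₀ (norm_sub_le_norm_one_sub_conj_mul (hb 0 h0) (hb z hz))
        (norm_nonneg _)
    refine ⟨dslope B 0, (Complex.differentiableOn_dslope unitDisk_mem_nhds).2 hBd, fun z hz => ?_,
      fun z hz => ?_⟩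
    · simpa using Complex.norm_dslope_le_div_of_mapsTo_ball hBd hBm hz
    · have := eq_add_mul_dslope B z
      rw [hB0, zero_add] at this
      rw [← mul_assoc, ← this, hB, div_mul_cancel₀ _ (hne z hz)]
  -- If `|φ 0| = 1`, the maximum principle makes `φ` constant; the identity without denominators
  -- still holds, with `ψ = 0`.
  · refine ⟨fun _ => 0, differentiableOn_const _, by simp, fun z hz => ?_⟩
    have hmax : IsMaxOn (norm ∘ φ) unitDisk 0 := fun z hz => by
      simpa [heq] using hb z hz
    have := Complex.eqOn_of_isPreconnected_of_isMaxOn_norm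
      (convex_ball (0 : ℂ) 1).isPreconnected Metric.isOpen_ball hd h0 hmax hz
    simp [this]

/-- The Schwarz–Pick bound for the derivative at the origin. -/
theorem norm_taylorCoeff_one_le {φ : ℂ → ℂ} (hd : DifferentiableOn ℂ φ unitDisk)
    (hb : ∀ z ∈ unitDisk, ‖φ z‖ ≤ 1) : ‖taylorCoeff φ 1‖ ≤ 1 - ‖φ 0‖ ^ 2 := by
  have h0 : (0 : ℂ) ∈ unitDisk := by simp [unitDisk]
  obtain ⟨ψ, hψd, hψb, hψ⟩ := exists_schur_step hd hb
  have hφa := analyticAt_of_unitDisk hd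
  have hψa := analyticAt_of_unitDisk hψd
  have hg : AnalyticAt ℂ (fun z => ψ z * (1 - (starRingEnd ℂ) (φ 0) * φ z)) 0 :=
    hψa.fun_mul (analyticAt_const.fun_sub (analyticAt_const.fun_mul hφa))
  have key := taylorCoeff_congr (n := 1) (mem_of_superset unitDisk_mem_nhds hψ)
  rw [taylorCoeff_sub hφa analyticAt_const, taylorCoeff_const_succ, taylorCoeff_id_mul hg,
    taylorCoeff_zero, sub_zero, Complex.conj_mul'] at key
  have hsq : ‖φ 0‖ ^ 2 ≤ 1 := pow_le_one₀ (norm_nonneg _) (hb 0 h0)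
  have hr : (1 - (‖φ 0‖ : ℂ) ^ 2) = ((1 - ‖φ 0‖ ^ 2 : ℝ) : ℂ) := by push_cast; rfl
  rw [key, hr, norm_mul, Complex.norm_real, Real.norm_of_nonneg (by linarith)]
  exact mul_le_of_le_one_left (by linarith) (hψb 0 h0)

/-- The first three coefficients of a Schwarz function. -/
theorem exists_schwarz_coeff {w : ℂ → ℂ} (hd : DifferentiableOn ℂ w unitDisk) (hw0 : w 0 = 0)
    (hb : ∀ z ∈ unitDisk, ‖w z‖ < 1) :
    ‖taylorCoeff w 1‖ ≤ 1 ∧ ∃ ξ ζ : ℂ, ‖ξ‖ ≤ 1 ∧ ‖ζ‖ ≤ 1 - ‖ξ‖ ^ 2 ∧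
      taylorCoeff w 2 = (1 - ‖taylorCoeff w 1‖ ^ 2) * ξ ∧
      taylorCoeff w 3 = (1 - ‖taylorCoeff w 1‖ ^ 2) *
        (ζ - (starRingEnd ℂ) (taylorCoeff w 1) * ξ ^ 2) := by
  have h0 : (0 : ℂ) ∈ unitDisk := by simp [unitDisk]
  -- As `w 0 = 0`, the first Schur step is just `w = zφ`. The second produces `ξ = ψ 0` and `ζ =
  -- ψ'(0)`, the latter controlled by Schwarz–Pick.
  obtain ⟨φ, hφd, hφb, hφ⟩ := exists_schur_step hd fun z hz => (hb z hz).le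
  obtain ⟨ψ, hψd, hψb, hψ⟩ := exists_schur_step hφd hφb
  have hφa := analyticAt_of_unitDisk hφd
  have hψa := analyticAt_of_unitDisk hψd
  have hcw : ∀ n, taylorCoeff w (n + 1) = taylorCoeff φ n := fun n => by
    rw [← taylorCoeff_id_mul hφa]
    refine taylorCoeff_congr (mem_of_superset unitDisk_mem_nhds fun z hz => ?_) _
    simpa [hw0] using hφ z hz
  have hl : AnalyticAt ℂ (fun z => 1 - (starRingEnd ℂ) (φ 0) * φ z) 0 :=
    analyticAt_const.fun_sub (analyticAt_const.fun_mul hφa)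
  have hcφ : ∀ n, taylorCoeff φ (n + 1) = ∑ i ∈ Finset.range (n + 1),
      taylorCoeff ψ i * taylorCoeff (fun z => 1 - (starRingEnd ℂ) (φ 0) * φ z) (n - i) := fun n => by
    have := taylorCoeff_congr (n := n + 1) (mem_of_superset unitDisk_mem_nhds hψ)
    rwa [taylorCoeff_sub hφa analyticAt_const, taylorCoeff_const_succ, sub_zero,
      taylorCoeff_id_mul (hψa.fun_mul hl), taylorCoeff_mul hψa hl] at this
  have hl0 : taylorCoeff (fun z => 1 - (starRingEnd ℂ) (φ 0) * φ z) 0 = 1 - ‖φ 0‖ ^ 2 := by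
    rw [taylorCoeff_zero, Complex.conj_mul']
  have hl1 : taylorCoeff (fun z => 1 - (starRingEnd ℂ) (φ 0) * φ z) 1
      = -((starRingEnd ℂ) (φ 0) * taylorCoeff φ 1) := by
    rw [taylorCoeff_sub analyticAt_const (analyticAt_const.fun_mul hφa), taylorCoeff_const_succ,
      taylorCoeff_const_mul, zero_sub]
  have hc1 : taylorCoeff w 1 = φ 0 := by rw [hcw 0, taylorCoeff_zero]
  have hφ1 : taylorCoeff φ 1 = (1 - ‖φ 0‖ ^ 2) * ψ 0 := by
    rw [hcφ 0, zero_add, Finset.sum_range_one, hl0, taylorCoeff_zero, mul_comm]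
  refine ⟨hc1 ▸ hφb 0 h0, ψ 0, taylorCoeff ψ 1, hψb 0 h0, norm_taylorCoeff_one_le hψd hψb, ?_, ?_⟩
  · rw [hcw 1, hc1, hφ1]
  · rw [hcw 2, hcφ 1, hc1]
    simp only [Finset.sum_range_succ, Finset.sum_range_zero, Nat.reduceSub, hl0, hl1, hφ1,
      taylorCoeff_zero ψ]
    ring

/-! ### The Hadamard product. -/

/-- Geometric bounds for the two coefficient sequences multiply, so the product series has positive
radius of convergence; uniqueness of power series then identifies its coefficients. -/
theorem analyticAt_taylorCoeff_hadamard {f g : ℂ → ℂ} (hf : AnalyticAt ℂ f 0)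
    (hg : AnalyticAt ℂ g 0) :
    AnalyticAt ℂ (hadamard f g) 0 ∧
      ∀ n, taylorCoeff (hadamard f g) n = taylorCoeff f n * taylorCoeff g n := by
  set p := FormalMultilinearSeries.ofScalars ℂ (taylorCoeff f) with hp
  set q := FormalMultilinearSeries.ofScalars ℂ (taylorCoeff g) with hq
  have hfp : HasFPowerSeriesAt f p 0 := hf.hasFPowerSeriesAt
  have hgq : HasFPowerSeriesAt g q 0 := hg.hasFPowerSeriesAt
  obtain ⟨r₁, hr₁, h₁⟩ := ENNReal.lt_iff_exists_nnreal_btwn.1 hfp.radius_pos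
  obtain ⟨r₂, hr₂, h₂⟩ := ENNReal.lt_iff_exists_nnreal_btwn.1 hgq.radius_pos
  obtain ⟨C₁, hC₁, hb₁⟩ := p.norm_mul_pow_le_of_lt_radius h₁
  obtain ⟨C₂, hC₂, hb₂⟩ := q.norm_mul_pow_le_of_lt_radius h₂
  set s := FormalMultilinearSeries.ofScalars ℂ (fun n => taylorCoeff f n * taylorCoeff g n) with hs
  have hrad : ((r₁ * r₂ : NNReal) : ENNReal) ≤ s.radius := by
    refine s.le_radius_of_bound (C₁ * C₂) fun n => ?_
    have e1 := hb₁ n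
    have e2 := hb₂ n
    rw [hp, FormalMultilinearSeries.ofScalars_norm] at e1
    rw [hq, FormalMultilinearSeries.ofScalars_norm] at e2
    rw [hs, FormalMultilinearSeries.ofScalars_norm, norm_mul]
    calc _ = (‖taylorCoeff f n‖ * (r₁ : ℝ) ^ n) * (‖taylorCoeff g n‖ * (r₂ : ℝ) ^ n) := by
            push_cast; ring
      _ ≤ _ := by gcongr
  have hpos : 0 < s.radius := by
    refine lt_of_lt_of_le ?_ hrad
    have h1 : 0 < r₁ := by exact_mod_cast hr₁
    have h2 : 0 < r₂ := by exact_mod_cast hr₂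
    exact_mod_cast mul_pos h1 h2
  have hsum : s.sum = hadamard f g := by
    ext z
    rw [hs]
    change FormalMultilinearSeries.ofScalarsSum _ z = _
    rw [FormalMultilinearSeries.ofScalars_sum_eq]
    simp [hadamard]
  have hsa : HasFPowerSeriesAt (hadamard f g) s 0 := by
    rw [← hsum]
    exact (s.hasFPowerSeriesOnBall hpos).hasFPowerSeriesAt
  refine ⟨hsa.analyticAt, fun n => ?_⟩
  have := hsa.analyticAt.hasFPowerSeriesAt.eq_formalMultilinearSeries hsa
  rw [hs, FormalMultilinearSeries.ofScalars_series_eq_iff] at this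
  exact congrFun this n

/-! ### The coefficients of `fDelta`. -/

theorem one_sub_ne_zero_of_mem {z : ℂ} (hz : z ∈ unitDisk) : 1 - z ≠ 0 := fun h => by
  rw [unitDisk, mem_ball_zero_iff, ← sub_eq_zero.1 h] at hz
  simp at hz

theorem one_add_ne_zero_of_mem {z : ℂ} (hz : z ∈ unitDisk) : 1 + z ≠ 0 := fun h => by
  have : z = -1 := by linear_combination h
  rw [unitDisk, mem_ball_zero_iff, this] at hz
  simp at hz

theorem cayley_mem_slitPlane {z : ℂ} (hz : z ∈ unitDisk) :
    (1 + z) / (1 - z) ∈ Complex.slitPlane := by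
  refine Complex.mem_slitPlane_iff.2 (Or.inl ?_)
  have h : 0 < Complex.normSq (1 - z) := Complex.normSq_pos.2 (one_sub_ne_zero_of_mem hz)
  have hn : z.re ^ 2 + z.im ^ 2 < 1 := by
    rw [unitDisk, mem_ball_zero_iff] at hz
    have := Complex.sq_norm z
    rw [Complex.normSq_apply] at this
    nlinarith [norm_nonneg z]
  rw [Complex.div_re, ← add_div]
  refine div_pos ?_ h
  simp
  nlinarith

/-- The derivative is `2δ` times the integrand of `fDelta`, which therefore has an elementary
primitive. -/
theorem hasDerivAt_cayley_cpow {δ : ℝ} {z : ℂ} (hz : z ∈ unitDisk) :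
    HasDerivAt (fun z : ℂ => ((1 + z) / (1 - z)) ^ (δ : ℂ))
      (2 * δ * (((1 + z) / (1 - z)) ^ (δ : ℂ) * (1 / (1 - z ^ 2)))) z := by
  have h1 := one_sub_ne_zero_of_mem hz
  have h2 := one_add_ne_zero_of_mem hz
  have hq : HasDerivAt (fun z : ℂ => (1 + z) / (1 - z)) (2 / (1 - z) ^ 2) z := by
    convert! ((hasDerivAt_id z).const_add 1).div ((hasDerivAt_id z).const_sub 1) h1 using 1
    simp only [id]
    ring
  convert! hq.cpow_const (c := (δ : ℂ)) (cayley_mem_slitPlane hz) using 1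
  rw [Complex.cpow_sub _ _ (div_ne_zero h2 h1), Complex.cpow_one]
  have h3 : 1 - z ^ 2 ≠ 0 := by
    rw [show 1 - z ^ 2 = (1 - z) * (1 + z) by ring]
    exact mul_ne_zero h1 h2
  generalize ((1 + z) / (1 - z)) ^ (δ : ℂ) = y
  field_simp
  ring

theorem ofReal_mul_mem_unitDisk {z : ℂ} (hz : z ∈ unitDisk) {s : ℝ} (hs : s ∈ Set.Icc (0 : ℝ) 1) :
    (s : ℂ) * z ∈ unitDisk := by
  rw [unitDisk, mem_ball_zero_iff] at hz ⊢
  rw [norm_mul, Complex.norm_real, Real.norm_of_nonneg hs.1]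
  exact (mul_le_of_le_one_left (norm_nonneg z) hs.2).trans_lt hz

theorem fDelta_eq {δ : ℝ} (hδ : δ ≠ 0) {z : ℂ} (hz : z ∈ unitDisk) :
    fDelta δ z = (((1 + z) / (1 - z)) ^ (δ : ℂ) - 1) / (2 * δ) := by
  have hδ' : (δ : ℂ) ≠ 0 := by exact_mod_cast hδ
  have hcont : ContinuousOn (fun z : ℂ => ((1 + z) / (1 - z)) ^ (δ : ℂ)) unitDisk :=
    fun z hz => (hasDerivAt_cayley_cpow hz).continuousAt.continuousWithinAt
  have hm : Set.MapsTo (fun s : ℝ => (s : ℂ) * z) (Set.uIcc 0 1) unitDisk := fun s hs =>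
    ofReal_mul_mem_unitDisk hz (by rwa [Set.uIcc_of_le zero_le_one] at hs)
  have hderiv : ∀ s ∈ Set.uIcc (0 : ℝ) 1,
      HasDerivAt (fun s : ℝ => ((1 + (s : ℂ) * z) / (1 - (s : ℂ) * z)) ^ (δ : ℂ) / (2 * δ))
        (((1 + (s : ℂ) * z) / (1 - (s : ℂ) * z)) ^ (δ : ℂ) * (1 / (1 - ((s : ℂ) * z) ^ 2)) * z)
        s := fun s hs => by
    have hin : HasDerivAt (fun s : ℝ => (s : ℂ) * z) z s := by
      simpa using (Complex.ofRealCLM.hasDerivAt (x := s)).mul_const z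
    convert! ((hasDerivAt_cayley_cpow (δ := δ) (hm hs)).comp s hin).div_const (2 * (δ : ℂ)) using 1
    field_simp
  have hint : ContinuousOn (fun s : ℝ => ((1 + (s : ℂ) * z) / (1 - (s : ℂ) * z)) ^ (δ : ℂ)
      * (1 / (1 - ((s : ℂ) * z) ^ 2)) * z) (Set.uIcc 0 1) := by
    have hin : ContinuousOn (fun s : ℝ => (s : ℂ) * z) (Set.uIcc 0 1) := by fun_prop
    refine ((hcont.comp hin hm).mul (continuousOn_const.div (by fun_prop) fun s hs => ?_)).mul
      continuousOn_const
    rw [show 1 - ((s : ℂ) * z) ^ 2 = (1 - s * z) * (1 + s * z) by ring]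
    exact mul_ne_zero (one_sub_ne_zero_of_mem (hm hs)) (one_add_ne_zero_of_mem (hm hs))
  rw [fDelta, intervalIntegral.integral_eq_sub_of_hasDerivAt hderiv hint.intervalIntegrable]
  simp [sub_div]

/-- This is the differential equation `(1 - z²) f' = 1 + 2δ f`, the source of the coefficient
recursion. -/
theorem hasDerivAt_fDelta {δ : ℝ} (hδ : δ ≠ 0) {z : ℂ} (hz : z ∈ unitDisk) :
    HasDerivAt (fDelta δ) ((1 + 2 * δ * fDelta δ z) / (1 - z ^ 2)) z := by
  have hδ' : (δ : ℂ) ≠ 0 := by exact_mod_cast hδ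
  have h := ((hasDerivAt_cayley_cpow (δ := δ) hz).sub_const 1).div_const (2 * (δ : ℂ))
  have hev : fDelta δ =ᶠ[𝓝 z] fun z => (((1 + z) / (1 - z)) ^ (δ : ℂ) - 1) / (2 * δ) :=
    mem_of_superset (Metric.isOpen_ball.mem_nhds hz) fun w hw => fDelta_eq hδ hw
  convert! h.congr_of_eventuallyEq hev using 1
  rw [fDelta_eq hδ hz]
  field_simp
  ring

theorem taylorCoeff_fDelta {δ : ℝ} (hδ : δ ≠ 0) :
    AnalyticAt ℂ (fDelta δ) 0 ∧ taylorCoeff (fDelta δ) 0 = 0 ∧ taylorCoeff (fDelta δ) 1 = 1 ∧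
      taylorCoeff (fDelta δ) 2 = δ ∧ taylorCoeff (fDelta δ) 3 = (2 * δ ^ 2 + 1) / 3 ∧
      taylorCoeff (fDelta δ) 4 = (δ ^ 3 + 2 * δ) / 3 := by
  have ha : AnalyticAt ℂ (fDelta δ) 0 := analyticAt_of_unitDisk fun z hz =>
    (hasDerivAt_fDelta hδ hz).differentiableAt.differentiableWithinAt
  have hd := ha.deriv
  have hzd : AnalyticAt ℂ (fun z => z * deriv (fDelta δ) z) 0 := analyticAt_fun_self.fun_mul hd
  have hlin : AnalyticAt ℂ (fun z => 1 + 2 * δ * fDelta δ z) 0 :=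
    analyticAt_const.fun_add (analyticAt_const.fun_mul ha)
  have hev : deriv (fDelta δ) =ᶠ[𝓝 0]
      fun z => (1 + 2 * δ * fDelta δ z) + z * (z * deriv (fDelta δ) z) := by
    filter_upwards [unitDisk_mem_nhds] with z hz
    have h3 : 1 - z ^ 2 ≠ 0 := by
      rw [show 1 - z ^ 2 = (1 - z) * (1 + z) by ring]
      exact mul_ne_zero (one_sub_ne_zero_of_mem hz) (one_add_ne_zero_of_mem hz)
    rw [(hasDerivAt_fDelta hδ hz).deriv]
    field_simp
    ring
  have f0 : fDelta δ 0 = 0 := by simp [fDelta]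
  have c0 : taylorCoeff (fDelta δ) 0 = 0 := by rw [taylorCoeff_zero, f0]
  have c1 : taylorCoeff (fDelta δ) 1 = 1 := by
    rw [taylorCoeff_one, hev.eq_of_nhds, f0]; simp
  have hrec : ∀ n : ℕ, (n + 2 : ℂ) * taylorCoeff (fDelta δ) (n + 2)
      = 2 * δ * taylorCoeff (fDelta δ) (n + 1) + n * taylorCoeff (fDelta δ) n := fun n => by
    have := taylorCoeff_congr hev (n + 1)
    rw [taylorCoeff_deriv, taylorCoeff_add hlin (analyticAt_fun_self.fun_mul hzd),
      taylorCoeff_add analyticAt_const (analyticAt_const.fun_mul ha), taylorCoeff_const_succ,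
      taylorCoeff_const_mul, taylorCoeff_id_mul hzd] at this
    have hz : taylorCoeff (fun z => z * deriv (fDelta δ) z) n = n * taylorCoeff (fDelta δ) n := by
      cases n with
      | zero => simp [taylorCoeff_zero]
      | succ n => rw [taylorCoeff_id_mul hd, taylorCoeff_deriv]; push_cast; ring
    rw [hz] at this
    push_cast at this
    linear_combination this
  have c2 : taylorCoeff (fDelta δ) 2 = δ := by
    have := hrec 0
    rw [c1, c0] at this
    push_cast at this
    linear_combination this / 2
  have c3 : taylorCoeff (fDelta δ) 3 = (2 * δ ^ 2 + 1) / 3 := by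
    have := hrec 1
    rw [c2, c1] at this
    push_cast at this
    linear_combination this / 3
  have c4 : taylorCoeff (fDelta δ) 4 = (δ ^ 3 + 2 * δ) / 3 := by
    have := hrec 2
    rw [c3, c2] at this
    push_cast at this
    linear_combination this / 4
  exact ⟨ha, c0, c1, c2, c3, c4⟩

/-! ### Estimating the second Hankel determinant. -/

/-- The second Hankel determinant in terms of the Schwarz coefficients of a function and its
inverse. -/
theorem hankel_expansion {A₂ A₃ A₄ c c₂ c₃ d d₂ d₃ L₁ L₂ L₃ u U₂ U₃ β γ : ℂ} (hL₁ : L₁ ≠ 0)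
    (hL₂ : L₂ ≠ 0) (hL₃ : L₃ ≠ 0) (hu : u ≠ 0)
    (e₂ : L₁ * A₂ = u * c) (e₃ : L₂ * A₃ = u * c₂ + U₂ * c ^ 2)
    (e₄ : L₃ * A₄ = u * c₃ + 2 * U₂ * c * c₂ + U₃ * c ^ 3)
    (f₂ : L₁ * -A₂ = u * d) (f₃ : L₂ * (2 * A₂ ^ 2 - A₃) = u * d₂ + U₂ * d ^ 2)
    (f₄ : L₃ * (-5 * A₂ ^ 3 + 5 * A₂ * A₃ - A₄) = u * d₃ + 2 * U₂ * d * d₂ + U₃ * d ^ 3) :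
    β * (A₂ * A₄) - γ * A₃ ^ 2 = (β * u * U₃ / (L₁ * L₃) - γ * u ^ 4 / L₁ ^ 4) * c ^ 4
      + (5 / 4 * β - γ) * u ^ 3 / (L₁ ^ 2 * L₂) * c ^ 2 * (c₂ - d₂)
      + β * u * U₂ / (L₁ * L₃) * c ^ 2 * (c₂ + d₂)
      + β * u ^ 2 / (2 * L₁ * L₃) * c * (c₃ - d₃)
      - γ * u ^ 2 / (4 * L₂ ^ 2) * (c₂ - d₂) ^ 2 := by
  have hd : d = -c := mul_left_cancel₀ hu (by linear_combination -e₂ - f₂)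
  subst hd
  have hA₂ : A₂ = u * c / L₁ := by field_simp; linear_combination e₂
  -- Subtracting the equation of the inverse from that of the function cancels the `U₂ c²` terms,
  -- since `d² = c²`.
  have hA₃ : A₃ = A₂ ^ 2 + u * (c₂ - d₂) / (2 * L₂) := by
    field_simp; linear_combination e₃ - f₃
  have hA₄ : A₄ = 5 / 2 * A₂ * (A₃ - A₂ ^ 2)
      + (u * (c₃ - d₃) + 2 * U₂ * c * (c₂ + d₂) + 2 * U₃ * c ^ 3) / (2 * L₃) := by
    field_simp; linear_combination e₄ - f₄
  rw [hA₄, hA₃, hA₂]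
  field_simp
  ring

/-- Here `x, v, w` are `|c|, |ξ|, |η|`, and the right side is the left at `v = w = 1`. The gap is `1
- x²` times `h1 + h2 + h3`. The splitting uses `v² + w² = ((v + w)² + (v - w)²)/2`, and `R ≤ 4S`
enters through `2Rx ≤ 8Sx ≤ 4S(1 + x)`. -/
theorem schur_bound_le {p R S x v w : ℝ} (hp : 0 ≤ p) (hS : 0 ≤ S)
    (hRS : R ≤ 4 * S) (hx0 : 0 ≤ x) (hx1 : x ≤ 1) (hv0 : 0 ≤ v) (hv1 : v ≤ 1) (hw0 : 0 ≤ w)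
    (hw1 : w ≤ 1) (hR : 0 ≤ R) :
    (1 - x ^ 2) * (p * x ^ 2 * (v + w) + R * x * ((1 - v ^ 2) + (1 - w ^ 2) + x * (v ^ 2 + w ^ 2)))
      + S * (1 - x ^ 2) ^ 2 * (v + w) ^ 2
      ≤ (1 - x ^ 2) * x ^ 2 * (2 * p + 2 * R) + 4 * S * (1 - x ^ 2) ^ 2 := by
  have hm : 0 ≤ 1 - x ^ 2 := by nlinarith
  have h1 : 0 ≤ p * x ^ 2 * (2 - (v + w)) := by
    have : 0 ≤ 2 - (v + w) := by linarith
    positivity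
  have h2 : 0 ≤ R * x * (1 - x) * (v - w) ^ 2 / 2 := by
    have : 0 ≤ 1 - x := by linarith
    positivity
  have h3 : 0 ≤ (1 - (v + w) ^ 2 / 4) * ((1 - x) * (4 * S * (1 + x) - 2 * R * x)) := by
    have a1 : 0 ≤ 1 - (v + w) ^ 2 / 4 := by nlinarith
    have a2 : 0 ≤ 1 - x := by linarith
    have a3 : 0 ≤ 4 * S * (1 + x) - 2 * R * x := by nlinarith [mul_nonneg hx0 hS]
    positivity
  have := mul_nonneg hm (add_nonneg (add_nonneg h1 h2) h3)
  linear_combination this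

/-- The plus sign before the conjugate in the `θ` term reflects that the second Schwarz function has
first coefficient `-c`. -/
theorem norm_schwarz_expansion_le {K P Q R S : ℝ} {c ξ η ζ θ : ℂ} (hP : 0 ≤ P) (hQ : 0 ≤ Q)
    (hR : 0 ≤ R) (hS : 0 ≤ S) (hRS : R ≤ 4 * S) (hc : ‖c‖ ≤ 1) (hξ : ‖ξ‖ ≤ 1) (hη : ‖η‖ ≤ 1)
    (hζ : ‖ζ‖ ≤ 1 - ‖ξ‖ ^ 2) (hθ : ‖θ‖ ≤ 1 - ‖η‖ ^ 2) {m : ℝ} (hm : m = 1 - ‖c‖ ^ 2) :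
    ‖(K : ℂ) * c ^ 4 + P * c ^ 2 * (m * ξ - m * η) + Q * c ^ 2 * (m * ξ + m * η)
      + R * c * (m * (ζ - (starRingEnd ℂ) c * ξ ^ 2) - m * (θ + (starRingEnd ℂ) c * η ^ 2))
      - S * (m * ξ - m * η) ^ 2‖
      ≤ |K| * (‖c‖ ^ 2) ^ 2 + (1 - ‖c‖ ^ 2) * ‖c‖ ^ 2 * (2 * (P + Q) + 2 * R)
        + 4 * S * (1 - ‖c‖ ^ 2) ^ 2 := by
  have hm0 : 0 ≤ m := by rw [hm]; nlinarith [norm_nonneg c]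
  have nr : ∀ r : ℝ, 0 ≤ r → ‖(r : ℂ)‖ = r := fun r hr => by
    rw [Complex.norm_real, Real.norm_of_nonneg hr]
  have nsub : ‖(m : ℂ) * ξ - m * η‖ ≤ m * (‖ξ‖ + ‖η‖) := by
    rw [← mul_sub, norm_mul, nr m hm0]; gcongr; exact norm_sub_le _ _
  have nadd : ‖(m : ℂ) * ξ + m * η‖ ≤ m * (‖ξ‖ + ‖η‖) := by
    rw [← mul_add, norm_mul, nr m hm0]; gcongr; exact norm_add_le _ _
  have n1 : ‖(K : ℂ) * c ^ 4‖ = |K| * (‖c‖ ^ 2) ^ 2 := by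
    rw [norm_mul, norm_pow, Complex.norm_real, Real.norm_eq_abs]; ring
  have n2 : ‖(P : ℂ) * c ^ 2 * (m * ξ - m * η)‖ ≤ P * ‖c‖ ^ 2 * (m * (‖ξ‖ + ‖η‖)) := by
    rw [norm_mul, norm_mul, norm_pow, nr P hP]; gcongr
  have n3 : ‖(Q : ℂ) * c ^ 2 * (m * ξ + m * η)‖ ≤ Q * ‖c‖ ^ 2 * (m * (‖ξ‖ + ‖η‖)) := by
    rw [norm_mul, norm_mul, norm_pow, nr Q hQ]; gcongr
  have n4 : ‖(R : ℂ) * c * (m * (ζ - (starRingEnd ℂ) c * ξ ^ 2)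
      - m * (θ + (starRingEnd ℂ) c * η ^ 2))‖ ≤
      R * ‖c‖ * (m * ((1 - ‖ξ‖ ^ 2) + (1 - ‖η‖ ^ 2) + ‖c‖ * (‖ξ‖ ^ 2 + ‖η‖ ^ 2))) := by
    rw [← mul_sub, norm_mul, norm_mul, norm_mul, nr R hR, nr m hm0]
    gcongr
    have a1 : ‖ζ - (starRingEnd ℂ) c * ξ ^ 2‖ ≤ ‖ζ‖ + ‖c‖ * ‖ξ‖ ^ 2 := by
      refine (norm_sub_le _ _).trans_eq ?_
      rw [norm_mul, norm_pow, RCLike.norm_conj]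
    have a2 : ‖θ + (starRingEnd ℂ) c * η ^ 2‖ ≤ ‖θ‖ + ‖c‖ * ‖η‖ ^ 2 := by
      refine (norm_add_le _ _).trans_eq ?_
      rw [norm_mul, norm_pow, RCLike.norm_conj]
    refine (norm_sub_le _ _).trans ?_
    linarith
  have n5 : ‖(S : ℂ) * (m * ξ - m * η) ^ 2‖ ≤ S * (m * (‖ξ‖ + ‖η‖)) ^ 2 := by
    rw [norm_mul, norm_pow, nr S hS]; gcongr
  have key := schur_bound_le (add_nonneg hP hQ) hS hRS (norm_nonneg c) hc (norm_nonneg ξ) hξ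
    (norm_nonneg η) hη hR
  rw [← hm] at key ⊢
  refine (norm_sub_le _ _).trans ?_
  refine (add_le_add_left ((norm_add_le _ _).trans (add_le_add_left ((norm_add_le _ _).trans
    (add_le_add_left (norm_add_le _ _) _)) _)) _).trans ?_
  rw [n1]
  linarith

/-- The bound of the second Hankel determinant as a quadratic polynomial in the squared modulus of
the first Schwarz coefficient. -/
theorem norm_hankel_le {A₂ A₃ A₄ c ξ η ζ θ : ℂ} {L₁ L₂ L₃ u U₂ U₃ β γ m : ℝ} (hL₁ : 0 < L₁)
    (hL₂ : 0 < L₂) (hL₃ : 0 < L₃) (hu : 0 < u) (hU₂ : 0 ≤ U₂) (hβ : 0 ≤ β) (hγ : 0 ≤ γ)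
    (hγβ : γ ≤ 5 / 4 * β) (hβγ : β * L₂ ^ 2 ≤ 2 * γ * (L₁ * L₃)) (hc : ‖c‖ ≤ 1) (hξ : ‖ξ‖ ≤ 1)
    (hη : ‖η‖ ≤ 1) (hζ : ‖ζ‖ ≤ 1 - ‖ξ‖ ^ 2) (hθ : ‖θ‖ ≤ 1 - ‖η‖ ^ 2) (hm : m = 1 - ‖c‖ ^ 2)
    (e₂ : L₁ * A₂ = u * c) (e₃ : L₂ * A₃ = u * (m * ξ) + U₂ * c ^ 2)
    (e₄ : L₃ * A₄ = u * (m * (ζ - (starRingEnd ℂ) c * ξ ^ 2)) + 2 * U₂ * c * (m * ξ) + U₃ * c ^ 3)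
    (f₂ : L₁ * -A₂ = u * -c) (f₃ : L₂ * (2 * A₂ ^ 2 - A₃) = u * (m * η) + U₂ * (-c) ^ 2)
    (f₄ : L₃ * (-5 * A₂ ^ 3 + 5 * A₂ * A₃ - A₄) = u * (m * (θ + (starRingEnd ℂ) c * η ^ 2))
      + 2 * U₂ * -c * (m * η) + U₃ * (-c) ^ 3) :
    ‖β * (A₂ * A₄) - γ * A₃ ^ 2‖ ≤ |β * u * U₃ / (L₁ * L₃) - γ * u ^ 4 / L₁ ^ 4| * (‖c‖ ^ 2) ^ 2
      + (1 - ‖c‖ ^ 2) * ‖c‖ ^ 2 * (2 * ((5 / 4 * β - γ) * u ^ 3 / (L₁ ^ 2 * L₂)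
        + β * u * U₂ / (L₁ * L₃)) + 2 * (β * u ^ 2 / (2 * L₁ * L₃)))
      + 4 * (γ * u ^ 2 / (4 * L₂ ^ 2)) * (1 - ‖c‖ ^ 2) ^ 2 := by
  have cast_ne : ∀ {r : ℝ}, 0 < r → (r : ℂ) ≠ 0 := fun hr => by exact_mod_cast hr.ne'
  have expansion := hankel_expansion (β := β) (γ := γ) (cast_ne hL₁) (cast_ne hL₂) (cast_ne hL₃)
    (cast_ne hu) e₂ e₃ e₄ f₂ f₃ f₄
  have hP : 0 ≤ 5 / 4 * β - γ := sub_nonneg.2 hγβ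
  have hRS : β * u ^ 2 / (2 * L₁ * L₃) ≤ 4 * (γ * u ^ 2 / (4 * L₂ ^ 2)) := by
    have h : 4 * (γ * u ^ 2 / (4 * L₂ ^ 2)) = γ * u ^ 2 / L₂ ^ 2 := by field_simp
    rw [h, div_le_div_iff₀ (by positivity) (by positivity)]
    linear_combination u ^ 2 * hβγ
  have := norm_schwarz_expansion_le (K := β * u * U₃ / (L₁ * L₃) - γ * u ^ 4 / L₁ ^ 4)
    (P := (5 / 4 * β - γ) * u ^ 3 / (L₁ ^ 2 * L₂)) (Q := β * u * U₂ / (L₁ * L₃))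
    (R := β * u ^ 2 / (2 * L₁ * L₃)) (S := γ * u ^ 2 / (4 * L₂ ^ 2)) (by positivity)
    (by positivity) (by positivity) (by positivity) hRS hc hξ hη hζ hθ hm
  rw [expansion]
  push_cast at this
  exact this

/-! ### Chebyshev values and the final quadratic. -/

theorem chebU_one (t : ℝ) : chebU 1 t = 2 * t := by
  simp [chebU]

theorem chebU_two (t : ℝ) : chebU 2 t = 4 * t ^ 2 - 1 := by
  simp [chebU, Polynomial.Chebyshev.U_two]

theorem chebU_three (t : ℝ) : chebU 3 t = 8 * t ^ 3 - 4 * t := by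
  have h := Polynomial.Chebyshev.U_add_two ℝ 1
  norm_num at h
  simp only [chebU, Nat.cast_ofNat, h, Polynomial.Chebyshev.U_two]
  simp
  ring

theorem quadratic_le_of_sign_cases {a b c₀ y M : ℝ} (hM : 0 < M) (hy0 : 0 ≤ y) (hy1 : y ≤ 1) :
    (0 ≤ a ∧ 0 ≤ b → c₀ + (a * y ^ 2 + 9 * b * y) / M ≤ c₀ + (a + 9 * b) / M) ∧
    (a ≤ 0 ∧ b ≤ 0 → c₀ + (a * y ^ 2 + 9 * b * y) / M ≤ c₀) ∧
    (0 < a ∧ b < 0 → c₀ + (a * y ^ 2 + 9 * b * y) / M ≤ max c₀ (c₀ + (a + 9 * b) / M)) ∧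
    (a < 0 → c₀ + (a * y ^ 2 + 9 * b * y) / M ≤ c₀ - 81 * b ^ 2 / (4 * a * M)) := by
  refine ⟨fun ⟨ha, hb⟩ => ?_, fun ⟨ha, hb⟩ => ?_, fun ⟨ha, hb⟩ => ?_, fun ha => ?_⟩
  · have : a * y ^ 2 + 9 * b * y ≤ a + 9 * b := by
      nlinarith [mul_nonneg ha (show 0 ≤ 1 - y ^ 2 by nlinarith),
        mul_nonneg hb (sub_nonneg.2 hy1)]
    gcongr
  · have : a * y ^ 2 + 9 * b * y ≤ 0 := by
      nlinarith [mul_nonneg (neg_nonneg.2 ha) (sq_nonneg y), mul_nonneg (neg_nonneg.2 hb) hy0]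
    linarith [div_nonpos_of_nonpos_of_nonneg this hM.le]
  -- By convexity the quadratic lies below its chord over `[0, 1]`, so the larger endpoint value
  -- bounds it.
  · have h : a * y ^ 2 + 9 * b * y ≤ y * (a + 9 * b) := by
      nlinarith [mul_nonneg ha.le (mul_nonneg hy0 (sub_nonneg.2 hy1))]
    have h' : (a * y ^ 2 + 9 * b * y) / M ≤ y * ((a + 9 * b) / M) := by
      rw [← mul_div_assoc]; gcongr
    rcases le_total 0 ((a + 9 * b) / M) with h0 | h0
    · exact le_max_of_le_right (by nlinarith)
    · exact le_max_of_le_left (by nlinarith)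
  -- Completing the square bounds the concave quadratic by its vertex value, wherever the vertex
  -- lies.
  · have h : 81 * b ^ 2 / (4 * a * M) = (81 * b ^ 2 / (4 * a)) / M := by
      rw [div_div]
    have h2 : a * y ^ 2 + 9 * b * y ≤ -(81 * b ^ 2 / (4 * a)) := by
      have : a * y ^ 2 + 9 * b * y + 81 * b ^ 2 / (4 * a) = a * (y + 9 * b / (2 * a)) ^ 2 := by
        have := ha.ne
        field_simp
        ring
      nlinarith [mul_nonneg (neg_nonneg.2 ha.le) (sq_nonneg (y + 9 * b / (2 * a)))]
    rw [h, sub_eq_add_neg, ← neg_div]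
    gcongr

/-- `E` stands for the factor `8δ⁴ - 4δ² + 5 = 5D - 12B` of `χ₁` and `χ₂`; it comes from the
coefficient `5/4 · 3/B - 9/D`. -/
theorem hankel_quadratic_eq {B D L₁ L₂ L₃ u U₂ K O E χ χ' M y : ℝ} (hB : 0 < B)
    (hD : 0 < D) (hL₁ : 0 < L₁) (hL₂ : 0 < L₂) (hL₃ : 0 < L₃)
    (hE : 15 * D - 36 * B = 3 * E) (hK : K = u * O / (6 * B * D * L₃ * L₁ ^ 4))
    (hM : M = 6 * B * D * L₃ * L₂ ^ 2 * L₁ ^ 4)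
    (hχ : χ = L₂ ^ 2 * u * O + 18 * L₁ ^ 3 * (3 * B * L₁ * L₃ - D * L₂ ^ 2) * u ^ 2
      - 9 * L₁ ^ 2 * L₂ * u * (L₃ * E * u ^ 2 + 4 * D * L₂ * L₁ * U₂))
    (hχ' : χ' = (L₂ * L₃ * E * u ^ 3 + 4 * D * L₁ * L₂ ^ 2 * u * U₂
      + L₁ * u ^ 2 * (2 * D * L₂ ^ 2 - 12 * B * L₁ * L₃)) * L₁ ^ 2) :
    K * y ^ 2 + (1 - y) * y * (2 * ((5 / 4 * (3 / B) - 9 / D) * u ^ 3 / (L₁ ^ 2 * L₂)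
      + 3 / B * u * U₂ / (L₁ * L₃)) + 2 * (3 / B * u ^ 2 / (2 * L₁ * L₃)))
      + 4 * (9 / D * u ^ 2 / (4 * L₂ ^ 2)) * (1 - y) ^ 2
      = 9 * u ^ 2 / (D * L₂ ^ 2) + (χ * y ^ 2 + 9 * χ' * y) / M := by
  have hE' : E = 5 * D - 12 * B := by linarith
  rw [hK, hM, hχ, hχ', hE']
  field_simp
  ring

end BiUnivalent

/-! ### The coefficient bound. -/

theorem corollary1 (lam δ t : ℝ) (hlam : 1 ≤ lam) (hδ : 1 ≤ δ)
    (ht : t ∈ Set.Ioc (1 / 2 : ℝ) 1) (f : ℂ → ℂ) (hf : f ∈ BiUnivalent.classA)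
    (hh : BiUnivalent.hadamard f (BiUnivalent.fDelta δ) ∈ BiUnivalent.classB lam t)
    (H : ℝ)
    (hH : H = ‖BiUnivalent.taylorCoeff f 2 * BiUnivalent.taylorCoeff f 4
      - BiUnivalent.taylorCoeff f 3 ^ 2‖) :
    (0 ≤ BiUnivalent.chi3 lam δ t ∧ 0 ≤ BiUnivalent.chi4 lam δ t →
      H ≤ BiUnivalent.phiTwo lam δ t) ∧
    (BiUnivalent.chi3 lam δ t ≤ 0 ∧ BiUnivalent.chi4 lam δ t ≤ 0 →
      H ≤ 36 * t ^ 2 / ((2 * δ ^ 2 + 1) ^ 2 * (2 * lam + 1) ^ 2)) ∧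
    (0 < BiUnivalent.chi3 lam δ t ∧ BiUnivalent.chi4 lam δ t < 0 →
      H ≤ max (36 * t ^ 2 / ((2 * δ ^ 2 + 1) ^ 2 * (2 * lam + 1) ^ 2))
        (BiUnivalent.phiTwo lam δ t)) ∧
    (BiUnivalent.chi3 lam δ t < 0 ∧ 0 < BiUnivalent.chi4 lam δ t →
      H ≤ max (BiUnivalent.phiCrit lam δ t) (BiUnivalent.phiTwo lam δ t)) := by
  open BiUnivalent in
  obtain ⟨ht0, -⟩ := ht
  have hδ0 : δ ≠ 0 := by linarith
  obtain ⟨hfda, -, g1, g2, g3, g4⟩ := taylorCoeff_fDelta hδ0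
  have hfa := analyticAt_of_unitDisk hf.1
  obtain ⟨hha, hcoef⟩ := analyticAt_taylorCoeff_hadamard hfa hfda
  set h := hadamard f (fDelta δ) with hh_def
  obtain ⟨-, k, ⟨hkd, -, hkh⟩, ⟨w, hwd, hw0, hwb, hw⟩, ⟨v, hvd, hv0, hvb, hv⟩⟩ := hh
  have hka := analyticAt_of_unitDisk hkd
  have h00 : h 0 = 0 := by rw [← taylorCoeff_zero h, hcoef, taylorCoeff_zero, hf.2.1, zero_mul]
  have h1 : taylorCoeff h 1 = 1 := by rw [hcoef, g1, taylorCoeff_one, hf.2.2, one_mul]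
  obtain ⟨-, k2, k3, k4⟩ := taylorCoeff_inverse hka hha h00 h1 hkh
  have hOh : ∀ {g : ℂ → ℂ}, AnalyticAt ℂ g 0 → AnalyticAt ℂ (bOperator lam g) 0 := fun hg =>
    (analyticAt_const.fun_mul (analyticAt_dslope hg)).fun_add (analyticAt_const.fun_mul hg.deriv)
  obtain ⟨e2, e3, e4⟩ := taylorCoeff_of_eq_chebGen (hOh hha) hwd hw0 hw
  obtain ⟨f2, f3, f4⟩ := taylorCoeff_of_eq_chebGen (hOh hka) hvd hv0 hv
  rw [taylorCoeff_bOperator hha] at e2 e3 e4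
  rw [taylorCoeff_bOperator hka] at f2 f3 f4
  norm_num only [k2, k3, k4, Nat.cast_one, Nat.cast_ofNat, one_mul] at e2 e3 e4 f2 f3 f4
  obtain ⟨hc, ξ, ζ, hξ, hζ, hc2, hc3⟩ := exists_schwarz_coeff hwd hw0 hwb
  obtain ⟨-, η, θ, hη, hθ, hd2, hd3⟩ := exists_schwarz_coeff hvd hv0 hvb
  have ht' : (2 * t : ℂ) ≠ 0 := by
    have : (t : ℂ) ≠ 0 := by exact_mod_cast (by linarith : t ≠ 0)
    simpa using this
  have hL₁ : 0 < lam + 1 := by linarith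
  have hL₂ : 0 < 2 * lam + 1 := by linarith
  have hL₃ : 0 < 3 * lam + 1 := by linarith
  have hd : taylorCoeff v 1 = -taylorCoeff w 1 :=
    mul_left_cancel₀ ht' (by linear_combination -e2 - f2)
  set c := taylorCoeff w 1 with hc_def
  set m : ℝ := 1 - ‖c‖ ^ 2 with hm
  have hmc : (1 - (‖c‖ : ℂ) ^ 2) = (m : ℂ) := by rw [hm]; push_cast; rfl
  rw [hd] at f2 f3 f4
  rw [hd, norm_neg, hmc] at hd2 hd3
  rw [hmc] at hc2 hc3
  rw [map_neg, neg_mul, sub_neg_eq_add] at hd3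
  rw [hc2] at e3 e4
  rw [hc3] at e4
  rw [hd2] at f3 f4
  rw [hd3] at f4
  set B : ℝ := δ * (δ ^ 3 + 2 * δ) with hB_def
  set D : ℝ := (2 * δ ^ 2 + 1) ^ 2 with hD_def
  have hB : 0 < B := by positivity
  have hD : 0 < D := by positivity
  -- These two comparisons yield the sign condition `γ ≤ 5β/4` and, with `3(2λ+1)² ≤ 4(λ+1)(3λ+1)`,
  -- the condition `R ≤ 4S`.
  have hBD : 12 * B ≤ 5 * D := by rw [hB_def, hD_def]; nlinarith [sq_nonneg (δ ^ 2 - 1)]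
  have hDB : 2 * D ≤ 9 * B := by
    rw [hB_def, hD_def]; nlinarith [sq_nonneg (δ ^ 2 - 1), one_le_pow₀ hδ (n := 2)]
  set K : ℝ := 3 / B * (2 * t) * (8 * t ^ 3 - 4 * t) / ((lam + 1) * (3 * lam + 1))
    - 9 / D * (2 * t) ^ 4 / (lam + 1) ^ 4 with hK
  -- Here `b₂b₄ = B/3` and `b₃² = D/9`.
  have hX : taylorCoeff f 2 * taylorCoeff f 4 - taylorCoeff f 3 ^ 2
      = ((3 / B : ℝ) : ℂ) * (taylorCoeff h 2 * taylorCoeff h 4)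
        - ((9 / D : ℝ) : ℂ) * taylorCoeff h 3 ^ 2 := by
    have b1 : (δ : ℂ) * (δ ^ 3 + 2 * δ) ≠ 0 := by exact_mod_cast hB.ne'
    have b2 : (2 * (δ : ℂ) ^ 2 + 1) ^ 2 ≠ 0 := by exact_mod_cast hD.ne'
    rw [hcoef, hcoef, hcoef, g2, g3, g4, hB_def, hD_def]
    push_cast
    generalize hb : (δ : ℂ) * (δ ^ 3 + 2 * δ) = b at *
    generalize hd : (2 * (δ : ℂ) ^ 2 + 1) = d at *
    have b3 : d ≠ 0 := fun h => b2 (by rw [h]; simp)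
    field_simp
    linear_combination (-9 * (taylorCoeff f 2 * taylorCoeff f 4)) * hb
  have hHle : H ≤ |K| * (‖c‖ ^ 2) ^ 2 + (1 - ‖c‖ ^ 2) * ‖c‖ ^ 2
      * (2 * ((5 / 4 * (3 / B) - 9 / D) * (2 * t) ^ 3 / ((lam + 1) ^ 2 * (2 * lam + 1))
      + 3 / B * (2 * t) * (4 * t ^ 2 - 1) / ((lam + 1) * (3 * lam + 1)))
      + 2 * (3 / B * (2 * t) ^ 2 / (2 * (lam + 1) * (3 * lam + 1))))
      + 4 * (9 / D * (2 * t) ^ 2 / (4 * (2 * lam + 1) ^ 2)) * (1 - ‖c‖ ^ 2) ^ 2 := by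
    have hγβ : 9 / D ≤ 5 / 4 * (3 / B) := by
      rw [← mul_div_assoc, div_le_div_iff₀ hD hB]
      linarith
    have hβγ : 3 / B * (2 * lam + 1) ^ 2 ≤ 2 * (9 / D) * ((lam + 1) * (3 * lam + 1)) := by
      have hL : 3 * (2 * lam + 1) ^ 2 ≤ 4 * ((lam + 1) * (3 * lam + 1)) := by nlinarith
      have hle : D * (2 * lam + 1) ^ 2 ≤ 6 * B * ((lam + 1) * (3 * lam + 1)) := by
        nlinarith [mul_le_mul hDB hL (by positivity) (by positivity)]
      rw [div_mul_eq_mul_div, mul_div_assoc', div_mul_eq_mul_div, div_le_div_iff₀ hB hD]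
      linarith
    rw [hH, hX]
    exact norm_hankel_le (U₂ := 4 * t ^ 2 - 1) (U₃ := 8 * t ^ 3 - 4 * t) hL₁ hL₂ hL₃
      (by linarith : 0 < 2 * t) (by nlinarith) (by positivity) (by positivity) hγβ hβγ hc hξ hη
      hζ hθ hm (by push_cast; linear_combination e2) (by push_cast; linear_combination e3)
      (by push_cast; linear_combination e4) (by push_cast; linear_combination f2)
      (by push_cast; linear_combination f3) (by push_cast; linear_combination f4)
  have hKabs : |K| = chebU 1 t * |Omega lam 1 δ t|
      / (6 * B * D * (3 * lam + 1) * (lam + 1) ^ 4) := by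
    have hΩ : K = chebU 1 t * Omega lam 1 δ t / (6 * B * D * (3 * lam + 1) * (lam + 1) ^ 4) := by
      -- At `μ = 1` the factor `μ² + 3μ - 4` vanishes.
      have : Omega lam 1 δ t = 18 * D * (lam + 1) ^ 3 * chebU 3 t
          - chebU 1 t ^ 3 * (3 * lam + 1) * (54 * B) := by
        rw [Omega, hB_def, hD_def]; ring
      rw [this, hK, chebU_one, chebU_three]
      field_simp
      ring
    rw [hΩ, abs_div, abs_mul, abs_of_pos (by rw [chebU_one]; linarith : 0 < chebU 1 t),
      abs_of_pos (by positivity : 0 < 6 * B * D * (3 * lam + 1) * (lam + 1) ^ 4)]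
  set M : ℝ := 6 * B * D * (3 * lam + 1) * (2 * lam + 1) ^ 2 * (lam + 1) ^ 4 with hM
  have hMpos : 0 < M := by positivity
  have hquad := hankel_quadratic_eq (u := chebU 1 t) (U₂ := chebU 2 t)
    (O := |Omega lam 1 δ t|) (E := 8 * δ ^ 4 - 4 * δ ^ 2 + 5) (χ := chi3 lam δ t)
    (χ' := chi4 lam δ t) (y := ‖c‖ ^ 2) hB hD hL₁ hL₂ hL₃ (by rw [hB_def, hD_def]; ring) hKabs hM
    (by rw [chi3, chi1, hB_def, hD_def]; ring) (by rw [chi4, chi2, hB_def, hD_def]; ring)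
  simp only [chebU_one, chebU_two] at hquad
  rw [hquad] at hHle
  have hzero : 36 * t ^ 2 / (D * (2 * lam + 1) ^ 2)
      = 9 * (2 * t) ^ 2 / (D * (2 * lam + 1) ^ 2) := by ring
  have htwo : phiTwo lam δ t = 9 * (2 * t) ^ 2 / (D * (2 * lam + 1) ^ 2)
      + (chi3 lam δ t + 9 * chi4 lam δ t) / M := by
    rw [phiTwo, chebU_one, hM, hB_def, hD_def, ← mul_assoc 6 δ]
  have hcrit : phiCrit lam δ t = 9 * (2 * t) ^ 2 / (D * (2 * lam + 1) ^ 2)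
      - 81 * chi4 lam δ t ^ 2 / (4 * chi3 lam δ t * M) := by
    rw [phiCrit, chebU_one, hM, ← mul_div_mul_left (27 * chi4 lam δ t ^ 2) _
      (by norm_num : (3 : ℝ) ≠ 0)]
    congr 2
    · ring
    · rw [hB_def, hD_def]; ring
  rw [hzero, htwo, hcrit]
  obtain ⟨q1, q2, q3, q4⟩ := quadratic_le_of_sign_cases (a := chi3 lam δ t) (b := chi4 lam δ t)
    (c₀ := 9 * (2 * t) ^ 2 / (D * (2 * lam + 1) ^ 2)) (y := ‖c‖ ^ 2) hMpos (sq_nonneg _)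
    (pow_le_one₀ (norm_nonneg c) hc)
  -- In the last case the vertex value alone is already an upper bound.
  exact ⟨fun h => hHle.trans (q1 h), fun h => hHle.trans (q2 h), fun h => hHle.trans (q3 h),
    fun h => le_max_of_le_left (hHle.trans (q4 h.1))⟩
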